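/- For a finite word $x$ over a finite alphabet $\Sigma$, let $A_D(x)$ be the least number of states of a (complete) deterministic finite automaton over $\Sigma$ such that $x$ is the only word of length $|x|$ that it accepts, and let $A_N(x)$ be the least number of states of a nondeterministic finite automaton over $\Sigma$, without $\varepsilon$-transitions, that accepts $x$ and has only one accepting path of length $|x|$ (a path being a sequence of labelled edges). For an infinite word $\mathbf u$, let $\mathbf u\restriction n$ be its prefix of length $n$, and put \[ I(\mathbf u)=\liminf_{n\to\infty}\frac{A_D(\mathbf u\restriction n)}{n},\qquad I_N(\mathbf u)=\liminf_{n\to\infty}\frac{A_N(\mathbf u\restriction n)}{n/2},\qquad S_N(\mathbf u)=\limsup_{n\to\infty}\frac{A_N(\mathbf u\restriction n)}{n/2}. \] Let $\mathbf t=t_0t_1t_2\ldots=0110100110010110\ldots$ be the infinite Thue(–Morse) word over $\{0,1\}$, where $t_b$ is the sum of the binary digits of $b$ modulo $2$. **Theorem.** $I(\mathbf t)\ge \frac12$. Moreover, $I_N(\mathbf t)=S_N(\mathbf t)=1$. -/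

import Mathlib

open Filter
open scoped ENNReal

/-- The Thue(–Morse) word `t = 0110100110010110…`: the `b`-th letter is the sum of the binary
digits of `b`, modulo 2. -/
def thueWord (b : ℕ) : Fin 2 := Fin.ofNat 2 (Nat.digits 2 b).sum

/-- The prefix of length `n` of an infinite word. -/
def wordPrefix {α : Type*} (u : ℕ → α) (n : ℕ) : Fin n → α := fun i => u i

/-- The DFA `M` accepts `w`, and `w` is the only word of its length that `M` accepts. -/
def DFAWitnesses {α σ : Type*} {n : ℕ} (M : DFA α σ) (w : Fin n → α) : Prop :=
  List.ofFn w ∈ M.accepts ∧ ∀ v : Fin n → α, List.ofFn v ∈ M.accepts → v = w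

/-- The deterministic automatic complexity `A_D(w)`: the least number of states of a
(complete) DFA over the alphabet `α` for which `w` is the only accepted word of its length. -/
noncomputable def detComplexity {α : Type*} {n : ℕ} (w : Fin n → α) : ℕ :=
  sInf {k : ℕ | ∃ M : DFA α (Fin k), DFAWitnesses M w}

/-- An accepting path of length `n` in an NFA (no `ε`-transitions): a sequence of states
`q 0, …, q n` and letters `x 0, …, x (n-1)`, from an initial to an accepting state, each step
`q i → q (i+1)` being along an edge labelled `x i`. -/
def IsAcceptingPath {α σ : Type*} {n : ℕ} (M : NFA α σ) (q : Fin (n + 1) → σ)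
    (x : Fin n → α) : Prop :=
  q 0 ∈ M.start ∧ (∀ i : Fin n, q i.succ ∈ M.step (q i.castSucc) (x i)) ∧
    q (Fin.last n) ∈ M.accept

/-- The NFA `M` accepts `w`, and `M` has only one accepting path of length `|w|`
(among all accepting paths of that length, whatever word they read). -/
def NFAWitnesses {α σ : Type*} {n : ℕ} (M : NFA α σ) (w : Fin n → α) : Prop :=
  (∃ q : Fin (n + 1) → σ, IsAcceptingPath M q w) ∧
    ∃! p : (Fin (n + 1) → σ) × (Fin n → α), IsAcceptingPath M p.1 p.2

/-- The nondeterministic automatic complexity `A_N(w)`: the least number of states of an NFA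
that accepts `w` and has only one accepting path of length `|w|`. -/
noncomputable def nondetComplexity {α : Type*} {n : ℕ} (w : Fin n → α) : ℕ :=
  sInf {k : ℕ | ∃ M : NFA α (Fin k), NFAWitnesses M w}

/-- The deterministic automatic Hausdorff dimension `I(u) = liminf A_D(u↾n) / n`. -/
noncomputable def detHausdorffDim {α : Type*} (u : ℕ → α) : ℝ≥0∞ :=
  liminf (fun n : ℕ => (detComplexity (wordPrefix u n) : ℝ≥0∞) / (n : ℝ≥0∞)) atTop

/-- The nondeterministic automatic Hausdorff dimension `I_N(u) = liminf A_N(u↾n) / (n/2)`. -/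
noncomputable def nondetHausdorffDim {α : Type*} (u : ℕ → α) : ℝ≥0∞ :=
  liminf (fun n : ℕ => (nondetComplexity (wordPrefix u n) : ℝ≥0∞) / ((n : ℝ≥0∞) / 2)) atTop

/-- The nondeterministic automatic packing dimension `S_N(u) = limsup A_N(u↾n) / (n/2)`. -/
noncomputable def nondetPackingDim {α : Type*} (u : ℕ → α) : ℝ≥0∞ :=
  limsup (fun n : ℕ => (nondetComplexity (wordPrefix u n) : ℝ≥0∞) / ((n : ℝ≥0∞) / 2)) atTop

/-! ### The Thue word is overlap-free -/

/-! If the edges of a unique accepting path can be rearranged into another path with the same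
endpoints, the result must be the same path. Hence two successive loops at one state commute; in an
overlap-free word they then have equal length and read a square (`eq_of_loops`). A fourth visit
would continue the square into an overlap, so each state is visited at most three times
(`not_visit_four`). The squares read at distinct thrice-visited states occupy disjoint blocks
(`disjoint_blocks`) and have distinct periods, since otherwise a loop could be exchanged between
them (`period_ne`). So m such states force m(m+1) ≤ n, and the n+1 visits need at least (n+1-√n)/2
states. Conversely, a path folded at its midpoint uses n/2+1 states for any word
(`exists_nfaWitnesses`), so A_N/n tends to 1/2. The deterministic bound follows from A_N ≤ A_D. -/

theorem thueWord_two_mul (n : ℕ) : thueWord (2 * n) = thueWord n := by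
  rcases Nat.eq_zero_or_pos n with rfl | hn
  · rfl
  · have h := Nat.digits_def' (b := 2) (n := 2 * n) (by norm_num) (by omega)
    have h1 : 2 * n % 2 = 0 := by omega
    have h2 : 2 * n / 2 = n := by omega
    simp [thueWord, h, h1, h2]

theorem thueWord_two_mul_add_one (n : ℕ) : thueWord (2 * n + 1) = thueWord n + 1 := by
  have h := Nat.digits_def' (b := 2) (n := 2 * n + 1) (by norm_num) (by omega)
  have h1 : (2 * n + 1) % 2 = 1 := by omega
  have h2 : (2 * n + 1) / 2 = n := by omega
  rw [thueWord, h, h1, h2, List.sum_cons]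
  apply Fin.ext
  simp [thueWord, Fin.val_add, Nat.add_comm]

/-- An infinite word is overlap-free if it has no factor of the form `w w a`, where `a` is the
first letter of `w`. -/
def OverlapFree {α : Type*} (u : ℕ → α) : Prop :=
  ∀ i p : ℕ, 0 < p → ¬ ∀ s ≤ p, u (i + s) = u (i + s + p)

theorem thueWord_succ_of_even {j : ℕ} (hj : j % 2 = 0) : thueWord (j + 1) = thueWord j + 1 := by
  obtain ⟨c, rfl⟩ : ∃ c, j = 2 * c := ⟨j / 2, by omega⟩
  rw [thueWord_two_mul_add_one, thueWord_two_mul]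

theorem overlapFree_thueWord : OverlapFree thueWord := by
  intro i p
  induction p using Nat.strong_induction_on generalizing i with
  | _ p ih =>
    intro hp h
    rcases Nat.even_or_odd' p with ⟨r, rfl | rfl⟩
    -- Even period: every second letter, starting at `i`, spells a factor of the word itself
    -- (complemented if `i` is odd), with half the period.
    · refine ih r (by omega) (i / 2) (by omega) fun u hu => ?_
      have hs := h (2 * u) (by omega)
      rcases Nat.even_or_odd' i with ⟨c, rfl | rfl⟩
      · rw [show 2 * c + 2 * u + 2 * r = 2 * (c + u + r) by ring,
          show 2 * c + 2 * u = 2 * (c + u) by ring, thueWord_two_mul, thueWord_two_mul] at hs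
        rwa [show 2 * c / 2 = c by omega]
      · rw [show 2 * c + 1 + 2 * u + 2 * r = 2 * (c + u + r) + 1 by ring,
          show 2 * c + 1 + 2 * u = 2 * (c + u) + 1 by ring, thueWord_two_mul_add_one,
          thueWord_two_mul_add_one] at hs
        rw [show (2 * c + 1) / 2 = c by omega]
        exact add_right_cancel hs
    -- Odd period: one of `i + s` and `i + s + p` is even, so the letters alternate throughout the
    -- second copy. An odd number of flips contradicts `h p`.
    · set p := 2 * r + 1 with hpr
      have alt : ∀ s < p, thueWord (i + p + s + 1) = thueWord (i + p + s) + 1 := by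
        intro s hs
        rcases Nat.mod_two_eq_zero_or_one (i + p + s) with h0 | h1
        · exact thueWord_succ_of_even h0
        · have e := thueWord_succ_of_even (j := i + s) (by omega)
          have e1 := h s (by omega)
          have e2 := h (s + 1) (by omega)
          rw [show i + p + s + 1 = i + (s + 1) + p by ring, ← e2,
            show i + p + s = i + s + p by ring, ← e1]
          exact e
      have two : ∀ r, thueWord (i + p + r) = thueWord (i + p) + Fin.ofNat 2 r ∨ p < r := by
        intro r
        induction r with
        | zero => left; simp
        | succ r ihr =>
          rcases ihr with ihr | ihr
          · rcases lt_or_ge r p with hr | hr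
            · left
              rw [← add_assoc, alt r hr, ihr, add_assoc]
              congr 1
              apply Fin.ext
              simp [Fin.val_add]
            · right; omega
          · right; omega
      have e := h p le_rfl
      rcases two p with h1 | h1
      · rw [← e] at h1
        have h3 : (Fin.ofNat 2 p) = 1 := by
          apply Fin.ext
          simp [hpr]
        rw [h3] at h1
        revert h1
        generalize thueWord (i + p) = z
        revert z
        decide
      · omega

/-! ### Automata with a unique accepting path -/

/-- The first `n` steps of `Q` and `X` form an accepting path of `M`. -/
def IsRun {α σ : Type*} (M : NFA α σ) (n : ℕ) (Q : ℕ → σ) (X : ℕ → α) : Prop :=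
  Q 0 ∈ M.start ∧ (∀ i < n, Q (i + 1) ∈ M.step (Q i) (X i)) ∧ Q n ∈ M.accept

/-- `Q` and `X` form an accepting path of length `n`, and it is the only one. -/
structure IsUniqueRun {α σ : Type*} (M : NFA α σ) (n : ℕ) (Q : ℕ → σ) (X : ℕ → α) : Prop where
  isRun : IsRun M n Q X
  state_eq : ∀ Q' X', IsRun M n Q' X' → ∀ i ≤ n, Q' i = Q i
  letter_eq : ∀ Q' X', IsRun M n Q' X' → ∀ i < n, X' i = X i

theorem IsRun.isAcceptingPath {α σ : Type*} {M : NFA α σ} {n : ℕ} {Q : ℕ → σ} {X : ℕ → α}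
    (h : IsRun M n Q X) :
    IsAcceptingPath M (fun i : Fin (n + 1) => Q i) (wordPrefix X n) :=
  ⟨h.1, fun i => h.2.1 i i.2, h.2.2⟩

theorem exists_isUniqueRun {α σ : Type*} {M : NFA α σ} {n : ℕ} {X : ℕ → α}
    (h : NFAWitnesses M (wordPrefix X n)) : ∃ Q, IsUniqueRun M n Q X := by
  obtain ⟨⟨q, hq⟩, p, -, hp⟩ := h
  -- Values beyond time `n` are junk; indexing by ℕ only avoids arithmetic in `Fin`.
  let Q : ℕ → σ := fun i => if hi : i < n + 1 then q ⟨i, hi⟩ else q 0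
  have hQ : ∀ i (hi : i < n + 1), Q i = q ⟨i, hi⟩ := fun i hi => dif_pos hi
  have hrun : IsRun M n Q X := by
    refine ⟨?_, fun i hi => ?_, ?_⟩
    · rw [hQ 0 (by omega)]; exact hq.1
    · rw [hQ i (by omega), hQ (i + 1) (by omega)]; exact hq.2.1 ⟨i, hi⟩
    · rw [hQ n (by omega)]; exact hq.2.2
  have key : ∀ Q' X', IsRun M n Q' X' →
      ((fun i : Fin (n + 1) => Q' i), wordPrefix X' n) =
        ((fun i : Fin (n + 1) => Q i), wordPrefix X n) := fun Q' X' h' =>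
    (hp _ h'.isAcceptingPath).trans (hp _ hrun.isAcceptingPath).symm
  exact ⟨Q, hrun, fun Q' X' h' i hi => congrFun (congrArg Prod.fst (key Q' X' h')) ⟨i, by omega⟩,
    fun Q' X' h' i hi => congrFun (congrArg Prod.snd (key Q' X' h')) ⟨i, hi⟩⟩

namespace IsUniqueRun

variable {α σ : Type*} {M : NFA α σ} {n : ℕ} {Q : ℕ → σ} {X : ℕ → α}

/-- Traversing the edges of a unique run in another order that is again a path does not change
anything. -/
theorem reroute (h : IsUniqueRun M n Q X) (g : ℕ → ℕ) (hg : ∀ m < n, g m < n)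
    (h0 : Q (g 0) = Q 0) (hstep : ∀ m, m + 1 < n → Q (g m + 1) = Q (g (m + 1)))
    (hlast : ∀ m, m + 1 = n → Q (g m + 1) = Q n) :
    ∀ m < n, Q (g m) = Q m ∧ X (g m) = X m := by
  have hrun : IsRun M n (fun m => if m < n then Q (g m) else Q n) (fun m => X (g m)) := by
    refine ⟨?_, fun i hi => ?_, ?_⟩
    · rcases Nat.eq_zero_or_pos n with rfl | hn
      · simpa using h.isRun.1
      · simpa [hn, h0] using h.isRun.1
    · have hs := h.isRun.2.1 (g i) (hg i hi)
      simp only [hi, if_true]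
      split_ifs with h1
      · rwa [← hstep i h1]
      · rwa [← hlast i (by omega)]
    · simpa using h.isRun.2.2
  intro m hm
  refine ⟨?_, h.letter_eq _ _ hrun m hm⟩
  have := h.state_eq _ _ hrun m hm.le
  simpa [hm] using this

/-- Apply `reroute` to the permutation of times that runs the second loop before the first. -/
theorem swap_loops (h : IsUniqueRun M n Q X) {i a b : ℕ} (hn : i + a + b ≤ n)
    (h1 : Q (i + a) = Q i) (h2 : Q (i + a + b) = Q i) :
    (∀ s < b, Q (i + a + s) = Q (i + s) ∧ X (i + a + s) = X (i + s)) ∧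
      ∀ s < a, Q (i + s) = Q (i + b + s) ∧ X (i + s) = X (i + b + s) := by
  rcases Nat.eq_zero_or_pos a with rfl | ha
  · simp
  rcases Nat.eq_zero_or_pos b with rfl | hb
  · simp
  have key := h.reroute
    (fun m => if m < i then m else if m < i + b then m + a else if m < i + a + b then m - b else m)
    (by intro m hm; split_ifs <;> omega)
    (by
      split_ifs with c1 c2 c3
      · rfl
      · have : i = 0 := by omega
        subst this; simpa using h1
      · omega
      · omega)
    (by
      intro m hm
      rcases lt_trichotomy (m + 1) i with c | c | c
      · rw [if_pos (by omega), if_pos c]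
      · rw [if_pos (by omega), if_neg (by omega), if_pos (by omega), c, h1]
      · rw [if_neg (by omega : ¬ m < i), if_neg (by omega : ¬ m + 1 < i)]
        rcases lt_trichotomy (m + 1) (i + b) with d | d | d
        · rw [if_pos (by omega), if_pos d]; congr 1; omega
        · rw [if_pos (by omega), if_neg (by omega), if_pos (by omega),
            show m + a + 1 = i + a + b by omega, show m + 1 - b = i by omega, h2]
        · rw [if_neg (by omega : ¬ m < i + b), if_neg (by omega : ¬ m + 1 < i + b)]
          rcases lt_trichotomy (m + 1) (i + a + b) with e | e | e
          · rw [if_pos (by omega), if_pos e]; congr 1; omega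
          · rw [if_pos (by omega), if_neg (by omega), e, h2,
              show m - b + 1 = i + a by omega, h1]
          · rw [if_neg (by omega), if_neg (by omega)])
    (by
      intro m hm
      rw [if_neg (by omega), if_neg (by omega)]
      split_ifs with c
      · rw [show m - b + 1 = i + a by omega, show n = i + a + b by omega, h1, h2]
      · rw [hm])
  constructor
  · intro s hs
    have := key (i + s) (by omega)
    rwa [if_neg (by omega), if_pos (by omega), show i + s + a = i + a + s by omega] at this
  · intro s hs
    have := key (i + b + s) (by omega)
    rwa [if_neg (by omega), if_neg (by omega), if_pos (by omega),
      show i + b + s - b = i + s by omega] at this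

/-- In an overlap-free word, two successive loops at the same state have the same length, and the
run repeats itself on them. -/
theorem eq_of_loops (h : IsUniqueRun M n Q X) (hX : OverlapFree X) {i a b : ℕ} (ha : 0 < a)
    (hb : 0 < b) (hn : i + a + b ≤ n) (h1 : Q (i + a) = Q i) (h2 : Q (i + a + b) = Q i) :
    a = b ∧ (∀ s ≤ a, Q (i + a + s) = Q (i + s)) ∧ ∀ s < a, X (i + a + s) = X (i + s) := by
  obtain ⟨hl, hr⟩ := h.swap_loops hn h1 h2
  have hab : a = b := by
    -- If the lengths differ, the shorter one is a period that reaches at least one letter past its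
    -- square: an overlap.
    rcases lt_trichotomy a b with c | c | c
    · refine absurd (fun s hs => ?_) (hX i a ha)
      rw [← (hl s (by omega)).2]
      congr 1; omega
    · exact c
    · refine absurd (fun s hs => ?_) (hX i b hb)
      rw [(hr s (by omega)).2]
      congr 1; omega
  subst hab
  refine ⟨rfl, fun s hs => ?_, fun s hs => (hl s hs).2⟩
  rcases hs.lt_or_eq with c | rfl
  · exact (hl s c).1
  · rw [h2, h1]

/-- The run visits the state `Q i` at the times `i`, `i + p` and `i + 2 * p`. -/
def _root_.VisitsThrice (n : ℕ) (Q : ℕ → σ) (i p : ℕ) : Prop :=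
  0 < p ∧ i + 2 * p ≤ n ∧ Q (i + p) = Q i ∧ Q (i + 2 * p) = Q i

theorem periodic (h : IsUniqueRun M n Q X) (hX : OverlapFree X) {i p : ℕ}
    (hv : VisitsThrice n Q i p) :
    (∀ s ≤ p, Q (i + p + s) = Q (i + s)) ∧ ∀ s < p, X (i + p + s) = X (i + s) := by
  obtain ⟨hp, hn, h1, h2⟩ := hv
  exact (h.eq_of_loops hX hp hp (by omega) h1 (by rw [← h2]; congr 1; omega)).2

theorem not_visit_four (h : IsUniqueRun M n Q X) (hX : OverlapFree X) {i j k l : ℕ} (hij : i < j)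
    (hjk : j < k) (hkl : k < l) (hn : l ≤ n) (h1 : Q j = Q i) (h2 : Q k = Q i)
    (h3 : Q l = Q i) : False := by
  obtain ⟨a, rfl⟩ := Nat.exists_eq_add_of_lt hij
  obtain ⟨b, rfl⟩ := Nat.exists_eq_add_of_lt hjk
  obtain ⟨c, rfl⟩ := Nat.exists_eq_add_of_lt hkl
  obtain ⟨e1, -, x1⟩ := h.eq_of_loops hX (i := i) (a := a + 1) (b := b + 1) (by omega) (by omega)
    (by omega) h1 h2
  obtain ⟨e2, -, x2⟩ := h.eq_of_loops hX (i := i + (a + 1)) (a := b + 1) (b := c + 1) (by omega)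
    (by omega) (by omega) (h2.trans h1.symm) (h3.trans h1.symm)
  have : a = b := by omega
  subst this
  refine hX i (a + 1) (by omega) fun s hs => ?_
  rcases hs.lt_or_eq with d | rfl
  · rw [← x1 s d]; congr 1; omega
  · have := x2 0 (by omega)
    simpa using this.symm

theorem visit_mem (h : IsUniqueRun M n Q X) (hX : OverlapFree X) {i p m : ℕ}
    (hv : VisitsThrice n Q i p) (hm : m ≤ n) (hQ : Q m = Q i) :
    m = i ∨ m = i + p ∨ m = i + 2 * p := by
  obtain ⟨hp, hn, h1, h2⟩ := hv
  by_contra! hne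
  obtain ⟨n1, n2, n3⟩ := hne
  rcases lt_or_gt_of_ne n1 with c | c
  · exact h.not_visit_four hX (i := m) (j := i) (k := i + p) (l := i + 2 * p) c (by omega)
      (by omega) hn hQ.symm (h1.trans hQ.symm) (h2.trans hQ.symm)
  rcases lt_or_gt_of_ne n2 with d | d
  · exact h.not_visit_four hX (i := i) (j := m) (k := i + p) (l := i + 2 * p) c d
      (by omega) hn hQ h1 h2
  rcases lt_or_gt_of_ne n3 with e | e
  · exact h.not_visit_four hX (i := i) (j := i + p) (k := m) (l := i + 2 * p) (by omega) d e hn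
      h1 hQ h2
  · exact h.not_visit_four hX (i := i) (j := i + p) (k := i + 2 * p) (l := m) (by omega)
      (by omega) e hm h1 h2 hQ

/-- The blocks of two different states that are visited thrice do not overlap. -/
theorem disjoint_blocks (h : IsUniqueRun M n Q X) (hX : OverlapFree X) {i p j r : ℕ}
    (hi : VisitsThrice n Q i p) (hj : VisitsThrice n Q j r) (hij : i < j) :
    i + 2 * p ≤ j := by
  by_contra! hlt
  have perQ := (h.periodic hX hi).1
  have hp := hi.1
  have hr := hj.1
  have hin := hi.2.1
  have hjn := hj.2.1
  -- Shifting by `p` inside the first block preserves states, so it must send visits of `Q j` to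
  -- visits of `Q j`. This leaves `p = r`, where the two squares merge into an overlap, and `p = 2 *
  -- r`, where shifting `j + r` gives a fourth visit.
  rcases lt_or_ge (i + p) j with c | c
  · have e := perQ (j - i - p) (by omega)
    rw [show i + p + (j - i - p) = j by omega] at e
    have := h.visit_mem hX hj (by omega) e.symm
    omega
  · have e := perQ (j - i) (by omega)
    rw [show i + p + (j - i) = j + p by omega, show i + (j - i) = j by omega] at e
    have hm := h.visit_mem hX hj (by omega) e
    rcases eq_or_ne p r with rfl | hpr
    · have x1 := (h.periodic hX hi).2
      have x2 := (h.periodic hX hj).2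
      refine hX i p hp fun s hs => ?_
      rcases hs.lt_or_eq with d | rfl
      · rw [← x1 s d]; congr 1; omega
      · rw [show i + s = j + (i + s - j) by omega, ← x2 (i + s - j) (by omega)]
        congr 1; omega
    · have hp2 : p = 2 * r := by omega
      rcases le_or_gt (j + r) (i + p) with d | d
      · have e' := perQ (j + r - i) (by omega)
        rw [show i + (j + r - i) = j + r by omega, hj.2.2.1] at e'
        have := h.visit_mem hX hj (by omega) e'
        omega
      · have e' := perQ (j + r - i - p) (by omega)
        rw [show i + p + (j + r - i - p) = j + r by omega, hj.2.2.1] at e'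
        have := h.visit_mem hX hj (by omega) e'.symm
        omega

/-- Different states that are visited thrice have different periods. -/
theorem period_ne (h : IsUniqueRun M n Q X) (hX : OverlapFree X) {i p j r : ℕ}
    (hi : VisitsThrice n Q i p) (hj : VisitsThrice n Q j r) (hij : i < j) : p ≠ r := by
  rintro rfl
  have hd := h.disjoint_blocks hX hi hj hij
  have hp := hi.1
  have hjn := hj.2.1
  -- The new path takes the loop at `Q i` three times and the loop at `Q j` once.
  have key := h.reroute (fun m => if m < i + 2 * p then m else if m < j + p then m - p else m)
    (by intro m hm; split_ifs <;> omega)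
    (by rw [if_pos (by omega)])
    (by
      intro m hm
      rcases lt_trichotomy (m + 1) (i + 2 * p) with c | c | c
      · rw [if_pos (by omega), if_pos c]
      · rw [if_pos (by omega), if_neg (by omega), if_pos (by omega), c, hi.2.2.2,
          show i + 2 * p - p = i + p by omega, hi.2.2.1]
      · rw [if_neg (by omega : ¬ m < i + 2 * p), if_neg (by omega : ¬ m + 1 < i + 2 * p)]
        rcases lt_trichotomy (m + 1) (j + p) with d | d | d
        · rw [if_pos (by omega), if_pos d]; congr 1; omega
        · rw [if_pos (by omega), if_neg (by omega), d, show m - p + 1 = j by omega, hj.2.2.1]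
        · rw [if_neg (by omega), if_neg (by omega)])
    (by
      intro m hm
      rw [if_neg (by omega), if_neg (by omega), hm])
  refine hX i p hp fun s hs => ?_
  rcases hs.lt_or_eq with d | rfl
  · rw [← (h.periodic hX hi).2 s d]; congr 1; omega
  · have := (key (i + 2 * s) (by omega)).2
    rw [if_neg (by omega), if_pos (by omega)] at this
    rw [show i + s + s = i + 2 * s by omega, ← this]
    congr 1; omega

end IsUniqueRun

/-! ### Counting the states of a unique run -/

theorem card_mul_card_le_two_mul_sum (S : Finset ℕ) (hS : ∀ x ∈ S, 0 < x) :
    S.card * (S.card + 1) ≤ 2 * ∑ x ∈ S, x := by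
  induction S using Finset.induction_on_max with
  | empty => simp
  | insert a S ha ih =>
    -- The maximum `a` of k+1 distinct positive integers is at least k+1.
    have hnot : a ∉ S := fun h => (ha a h).false
    have hcard : S.card ≤ a - 1 := by
      have : S ⊆ Finset.Ico 1 a := fun x hx =>
        Finset.mem_Ico.2 ⟨hS x (Finset.mem_insert_of_mem hx), ha x hx⟩
      simpa using Finset.card_le_card this
    have hpos := hS a (Finset.mem_insert_self a S)
    have := ih fun x hx => hS x (Finset.mem_insert_of_mem hx)
    rw [Finset.card_insert_of_notMem hnot, Finset.sum_insert hnot]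
    have h2 : S.card + 1 ≤ a := by omega
    nlinarith

/-- Here `m` counts the thrice-visited states. Each state accounts for two of the n+1 visits, plus
one more if it is among these. -/
theorem IsUniqueRun.exists_le_two_mul_card {α σ : Type*} [Fintype σ] {M : NFA α σ} {n : ℕ}
    {Q : ℕ → σ} {X : ℕ → α} (h : IsUniqueRun M n Q X) (hX : OverlapFree X) :
    ∃ m, m * m ≤ n ∧ n + 1 ≤ 2 * Fintype.card σ + m := by
  classical
  let V : σ → Finset ℕ := fun s => (Finset.range (n + 1)).filter fun i => Q i = s
  let T : Finset σ := Finset.univ.filter fun s => 3 ≤ (V s).card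
  have hV : ∀ {s i}, i ∈ V s → i ≤ n ∧ Q i = s := fun {s i} hi => by
    have := Finset.mem_filter.1 hi
    exact ⟨by simpa [Nat.lt_succ_iff] using this.1, this.2⟩
  have hthree : ∀ s, (V s).card ≤ 3 := by
    intro s
    by_contra! hc
    let f := (V s).orderEmbOfCardLe hc
    have hf : ∀ k, f k ≤ n ∧ Q (f k) = s := fun k =>
      hV ((V s).orderEmbOfCardLe_mem hc k)
    exact h.not_visit_four hX (f.strictMono (show (0 : Fin 4) < 1 by decide))
      (f.strictMono (show (1 : Fin 4) < 2 by decide))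
      (f.strictMono (show (2 : Fin 4) < 3 by decide)) (hf 3).1
      ((hf 1).2.trans (hf 0).2.symm) ((hf 2).2.trans (hf 0).2.symm)
      ((hf 3).2.trans (hf 0).2.symm)
  have hT : ∀ s, s ∈ T → ∃ i p, VisitsThrice n Q i p ∧ Q i = s := by
    intro s hs
    have hc : 3 ≤ (V s).card := (Finset.mem_filter.1 hs).2
    let f := (V s).orderEmbOfCardLe hc
    have hf : ∀ k, f k ≤ n ∧ Q (f k) = s := fun k =>
      hV ((V s).orderEmbOfCardLe_mem hc k)
    have h01 : f 0 < f 1 := f.strictMono (by decide)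
    have h12 : f 1 < f 2 := f.strictMono (by decide)
    obtain ⟨a, ha⟩ := Nat.exists_eq_add_of_lt h01
    obtain ⟨b, hb⟩ := Nat.exists_eq_add_of_lt h12
    have hn := (hf 2).1
    have q1 : Q (f 0 + (a + 1)) = Q (f 0) := by
      rw [← add_assoc, ← ha, (hf 1).2, (hf 0).2]
    have q2 : Q (f 0 + (a + 1) + (b + 1)) = Q (f 0) := by
      rw [← add_assoc, ← add_assoc, ← ha, ← hb, (hf 2).2, (hf 0).2]
    have e := (h.eq_of_loops hX (by omega) (by omega) (by omega) q1 q2).1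
    refine ⟨f 0, a + 1, ⟨by omega, by omega, q1, ?_⟩, (hf 0).2⟩
    rw [← q2]
    congr 1
    omega
  choose! I P hIP using hT
  have hne : ∀ s ∈ T, ∀ t ∈ T, s ≠ t → I s ≠ I t := fun s hs t ht hst e =>
    hst (by rw [← (hIP s hs).2, ← (hIP t ht).2, e])
  have hinj : Set.InjOn P T := by
    intro s hs t ht e
    by_contra hst
    rcases lt_or_gt_of_ne (hne s hs t ht hst) with c | c
    · exact h.period_ne hX (hIP s hs).1 (hIP t ht).1 c e
    · exact h.period_ne hX (hIP t ht).1 (hIP s hs).1 c e.symm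
  have hdisj : Set.PairwiseDisjoint (T : Set σ) fun s => Finset.Ico (I s) (I s + 2 * P s) := by
    intro s hs t ht hst
    rw [Function.onFun, Finset.disjoint_left]
    intro x hx hx'
    rw [Finset.mem_Ico] at hx hx'
    rcases lt_or_gt_of_ne (hne s hs t ht hst) with c | c
    · have := h.disjoint_blocks hX (hIP s hs).1 (hIP t ht).1 c
      omega
    · have := h.disjoint_blocks hX (hIP t ht).1 (hIP s hs).1 c
      omega
  have hsum : ∑ s ∈ T, 2 * P s ≤ n := by
    have hsub : T.biUnion (fun s => Finset.Ico (I s) (I s + 2 * P s)) ⊆ Finset.range n := by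
      intro x hx
      obtain ⟨s, hs, hx⟩ := Finset.mem_biUnion.1 hx
      have := (hIP s hs).1.2.1
      rw [Finset.mem_Ico] at hx
      exact Finset.mem_range.2 (by omega)
    have := Finset.card_le_card hsub
    rw [Finset.card_biUnion hdisj] at this
    simpa using this
  refine ⟨T.card, ?_, ?_⟩
  · have hsq := card_mul_card_le_two_mul_sum (T.image P) (by
      intro x hx
      obtain ⟨s, hs, rfl⟩ := Finset.mem_image.1 hx
      exact (hIP s hs).1.1)
    rw [Finset.card_image_of_injOn hinj, Finset.sum_image hinj, Finset.mul_sum] at hsq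
    nlinarith
  · have hfib := Finset.card_eq_sum_card_fiberwise (f := Q) (s := Finset.range (n + 1))
      (t := Finset.univ) (fun _ _ => Finset.mem_coe.2 (Finset.mem_univ _))
    rw [Finset.card_range] at hfib
    rw [hfib]
    calc ∑ s, (V s).card ≤ ∑ s, (2 + if s ∈ T then 1 else 0) := by
          refine Finset.sum_le_sum fun s _ => ?_
          have := hthree s
          by_cases hs : s ∈ T
          · simp only [hs, if_true]; omega
          · have hs' : ¬ 3 ≤ (V s).card := fun hc => hs (by simp [T, hc])
            simp only [hs, if_false]; omega
      _ = 2 * Fintype.card σ + T.card := by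
          rw [Finset.sum_add_distrib, Finset.sum_const, Finset.card_univ, smul_eq_mul, mul_comm,
            Finset.sum_ite_mem, Finset.univ_inter, Finset.sum_const, smul_eq_mul, mul_one]

/-! ### An automaton with about half as many states as letters -/

/-- The `i`-th state of the path `0, 1, …, m, m, …, 1, 0`. -/
def foldedPath (m i : ℕ) : ℕ := if i ≤ m then i else 2 * m + 1 - i

/-- A walk that follows the steps of `foldedPath m` and has the length `n` and end point of an
initial segment of it of length `n > m` is that initial segment. -/
theorem eq_foldedPath {m n : ℕ} (hm : m < n) (hn : n ≤ 2 * m + 1) (f : ℕ → ℕ) (h0 : f 0 = 0)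
    (hstep : ∀ i < n, ∃ j < n, f i = foldedPath m j ∧ f (i + 1) = foldedPath m (j + 1))
    (hlast : f n = foldedPath m n) : ∀ i ≤ n, f i = foldedPath m i := by
  have hs : ∀ i < n, f (i + 1) = f i + 1 ∨ f i = f (i + 1) + 1 ∨ (f i = m ∧ f (i + 1) = m) := by
    intro i hi
    obtain ⟨j, hj, e1, e2⟩ := hstep i hi
    rw [e1, e2, foldedPath, foldedPath]
    split_ifs <;> omega
  have hup : ∀ d i, i + d ≤ n → f (i + d) ≤ f i + d ∧ f i ≤ f (i + d) + d := by
    intro d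
    induction d with
    | zero => intro i _; simp
    | succ d ih =>
      intro i hi
      have := ih i (by omega)
      have := hs (i + d) (by omega)
      rw [← add_assoc]
      omega
  have hl : f n = 2 * m + 1 - n := by
    rw [hlast, foldedPath, if_neg (by omega)]
  -- Every step except the loop at `m` changes parity, and `f n` has the parity of n+1, so the loop
  -- is used.
  have hex : ∃ r < n, f r = m ∧ f (r + 1) = m := by
    by_contra! hno
    have hpar : ∀ i ≤ n, f i % 2 = i % 2 := by
      intro i
      induction i with
      | zero => intro _; rw [h0]
      | succ i ih =>
        intro hi
        have := ih (by omega)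
        rcases hs i (by omega) with c | c | c
        · omega
        · omega
        · exact absurd c.2 (hno i (by omega) c.1)
    have := hpar n le_rfl
    omega
  obtain ⟨r, hr, e1, e2⟩ := hex
  have b1 := hup r 0 (by omega)
  have b2 := hup (n - (r + 1)) (r + 1) (by omega)
  rw [show r + 1 + (n - (r + 1)) = n by omega] at b2
  rw [zero_add] at b1
  -- Reaching `m` takes at least `m` steps and descending to the end point takes at least `n - m -
  -- 1`, so no step is wasted.
  have hrm : r = m := by omega
  subst hrm
  intro i hi
  rw [foldedPath]
  split_ifs with c
  · have c1 := hup i 0 (by omega)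
    have c2 := hup (r - i) i (by omega)
    rw [show i + (r - i) = r by omega] at c2
    rw [zero_add] at c1
    omega
  · have c1 := hup (i - (r + 1)) (r + 1) (by omega)
    have c2 := hup (n - i) i (by omega)
    rw [show r + 1 + (i - (r + 1)) = i by omega] at c1
    rw [show i + (n - i) = n by omega] at c2
    omega

theorem exists_nfaWitnesses {α : Type*} {n : ℕ} (hn : 2 ≤ n) (w : Fin n → α) :
    ∃ M : NFA α (Fin (n / 2 + 1)), NFAWitnesses M w := by
  set m := n / 2 with hm
  have hlt : ∀ i, i ≤ n → foldedPath m i < m + 1 := by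
    intro i hi; rw [foldedPath]; split_ifs <;> omega
  let M : NFA α (Fin (m + 1)) :=
    { start := {s | s.1 = 0}
      accept := {s | s.1 = foldedPath m n}
      step := fun s a => {s' | ∃ i : Fin n, s.1 = foldedPath m i ∧ s'.1 = foldedPath m (i + 1) ∧
        a = w i} }
  let q : Fin (n + 1) → Fin (m + 1) := fun i => ⟨foldedPath m i, hlt i (by omega)⟩
  have hq : IsAcceptingPath M q w := by
    refine ⟨?_, fun i => ⟨i, ?_, ?_, rfl⟩, ?_⟩
    · simp [M, q, foldedPath]
    · simp [q]
    · simp [q]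
    · simp [M, q]
  refine ⟨M, ⟨q, hq⟩, (q, w), hq, ?_⟩
  rintro ⟨q', x'⟩ ⟨p0, pstep, plast⟩
  have hf := eq_foldedPath (m := m) (n := n) (by omega) (by omega)
    (fun i => if hi : i < n + 1 then (q' ⟨i, hi⟩).1 else 0) (by simpa [M] using p0)
    (by
      intro i hi
      obtain ⟨j, e1, e2, -⟩ := pstep ⟨i, hi⟩
      refine ⟨j, j.2, ?_, ?_⟩
      · simp only [show i < n + 1 by omega, dif_pos]; exact e1
      · simp only [show i + 1 < n + 1 by omega, dif_pos]; exact e2)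
    (by simp only [show n < n + 1 by omega, dif_pos]; exact plast)
  have hq' : q' = q := by
    funext i
    apply Fin.ext
    have := hf i (by omega)
    rwa [dif_pos i.2] at this
  subst hq'
  refine Prod.ext rfl (funext fun i => ?_)
  obtain ⟨j, e1, e2, e3⟩ := pstep i
  -- An edge determines its time: ascending, looping and descending steps are told apart by their
  -- end states.
  have hij : i = j := by
    simp only [q, Fin.val_castSucc, Fin.val_succ, foldedPath] at e1 e2
    apply Fin.ext
    split_ifs at e1 e2 <;> omega
  rw [hij]; rw [hij] at e3; exact e3

/-! ### Comparison of the two complexities -/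

theorem DFAWitnesses.toNFA {α σ : Type*} {n : ℕ} {M : DFA α σ} {w : Fin n → α}
    (h : DFAWitnesses M w) : NFAWitnesses M.toNFA w := by
  let run : (Fin n → α) → Fin (n + 1) → σ := fun x i => M.eval ((List.ofFn x).take i)
  have hsucc : ∀ x (i : Fin n), run x i.succ = M.step (run x i.castSucc) (x i) := by
    intro x i
    have : (List.ofFn x).take (i + 1) = (List.ofFn x).take i ++ [x i] := by
      rw [List.take_succ_eq_append_getElem (by simp)]
      simp
    simp only [run, Fin.val_succ, Fin.val_castSucc]
    rw [this, DFA.eval_append_singleton]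
  have hlast : ∀ x, run x (Fin.last n) = M.eval (List.ofFn x) := by
    intro x
    simp only [run, Fin.val_last]
    rw [List.take_of_length_le (by simp)]
  have hw : IsAcceptingPath M.toNFA (run w) w := by
    refine ⟨by simp [run], fun i => ?_, ?_⟩
    · rw [hsucc]; simp
    · rw [hlast]; exact h.1
  refine ⟨⟨_, hw⟩, (run w, w), hw, ?_⟩
  rintro ⟨q, x⟩ ⟨p0, pstep, plast⟩
  dsimp only at p0 pstep plast
  have hq : q = run x := by
    funext i
    induction i using Fin.induction with
    | zero => simpa [run] using p0
    | succ i ih =>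
      have := pstep i
      rw [hsucc, ← ih]
      simpa using this
  subst hq
  rw [hlast] at plast
  have := h.2 x plast
  subst this
  rfl

/-- Needed because `sInf ∅ = 0` would make `detComplexity` meaningless. State `n + 1` is a dead
sink. -/
theorem exists_dfaWitnesses {α : Type*} {n : ℕ} (w : Fin n → α) :
    ∃ M : DFA α (Fin (n + 2)), DFAWitnesses M w := by
  classical
  let M : DFA α (Fin (n + 2)) :=
    { start := 0
      accept := {s | s.1 = n}
      step := fun s a => if h : s.1 < n then
        (if a = w ⟨s.1, h⟩ then ⟨s.1 + 1, by omega⟩ else Fin.last _) else Fin.last _ }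
  have hval : ∀ s a, (M.step s a).1 = n + 1 ∨
      ∃ h : s.1 < n, a = w ⟨s.1, h⟩ ∧ (M.step s a).1 = s.1 + 1 := by
    intro s a
    simp only [M]
    split_ifs with h1 h2
    · exact Or.inr ⟨h1, h2, rfl⟩
    · left; rfl
    · left; rfl
  have hsucc : ∀ (x : Fin n → α) (i : ℕ) (hi : i < n),
      M.eval ((List.ofFn x).take (i + 1)) = M.step (M.eval ((List.ofFn x).take i)) (x ⟨i, hi⟩) := by
    intro x i hi
    have : (List.ofFn x).take (i + 1) = (List.ofFn x).take i ++ [x ⟨i, hi⟩] := by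
      rw [List.take_succ_eq_append_getElem (by simpa using hi)]
      simp
    rw [this, DFA.eval_append_singleton]
  refine ⟨M, ?_, fun v hv => ?_⟩
  · have key : ∀ i ≤ n, (M.eval ((List.ofFn w).take i)).1 = i := by
      intro i
      induction i with
      | zero => intro _; simp [M]
      | succ i ih =>
        intro hi
        have e := ih (by omega)
        rw [hsucc w i (by omega)]
        have hlt : (M.eval ((List.ofFn w).take i)).1 < n := by omega
        have : w ⟨i, by omega⟩ = w ⟨(M.eval ((List.ofFn w).take i)).1, hlt⟩ := by
          congr 1; exact Fin.ext e.symm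
        change (dite _ _ _ : Fin (n + 2)).1 = _
        rw [dif_pos hlt, if_pos this]
        simp only [e]
    have := key n le_rfl
    rw [List.take_of_length_le (by simp)] at this
    exact this
  · have key : ∀ i ≤ n, (M.eval ((List.ofFn v).take i)).1 = n + 1 ∨
        ((M.eval ((List.ofFn v).take i)).1 = i ∧ ∀ j : Fin n, j.1 < i → v j = w j) := by
      intro i
      induction i with
      | zero => intro _; right; simp [M]
      | succ i ih =>
        intro hi
        rw [hsucc v i (by omega)]
        rcases hval (M.eval ((List.ofFn v).take i)) (v ⟨i, by omega⟩) with c | ⟨c, d, e⟩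
        · exact Or.inl c
        · rcases ih (by omega) with f | ⟨f, g⟩
          · omega
          · right
            refine ⟨by rw [e, f], fun j hj => ?_⟩
            rcases Nat.lt_succ_iff_lt_or_eq.1 hj with k | k
            · exact g j k
            · have h1 : j = ⟨i, by omega⟩ := Fin.ext k
              rw [h1, d]
              congr 1
              exact Fin.ext f
    have hv' : (M.eval (List.ofFn v)).1 = n := hv
    have := key n le_rfl
    rw [List.take_of_length_le (by simp)] at this
    rcases this with c | c
    · omega
    · exact funext fun j => c.2 j j.2

theorem nondetComplexity_le_detComplexity {α : Type*} {n : ℕ} (w : Fin n → α) :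
    nondetComplexity w ≤ detComplexity w := by
  obtain ⟨M, hM⟩ : detComplexity w ∈ {k : ℕ | ∃ M : DFA α (Fin k), DFAWitnesses M w} :=
    Nat.sInf_mem ⟨n + 2, exists_dfaWitnesses w⟩
  exact Nat.sInf_le ⟨M.toNFA, hM.toNFA⟩

theorem nondetComplexity_le {α : Type*} {n : ℕ} (hn : 2 ≤ n) (w : Fin n → α) :
    nondetComplexity w ≤ n / 2 + 1 :=
  Nat.sInf_le (exists_nfaWitnesses hn w)

theorem OverlapFree.exists_le_two_mul_nondetComplexity {α : Type*} {u : ℕ → α}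
    (hu : OverlapFree u) {n : ℕ} (hn : 2 ≤ n) :
    ∃ m, m * m ≤ n ∧ n + 1 ≤ 2 * nondetComplexity (wordPrefix u n) + m := by
  obtain ⟨M, hM⟩ : nondetComplexity (wordPrefix u n) ∈
      {k : ℕ | ∃ M : NFA α (Fin k), NFAWitnesses M (wordPrefix u n)} :=
    Nat.sInf_mem ⟨_, exists_nfaWitnesses hn _⟩
  obtain ⟨Q, hQ⟩ := exists_isUniqueRun hM
  simpa using hQ.exists_le_two_mul_card hu

/-! ### The limits -/

theorem OverlapFree.tendsto_nondetComplexity_div {α : Type*} {u : ℕ → α} (hu : OverlapFree u) :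
    Tendsto (fun n : ℕ => (nondetComplexity (wordPrefix u n) : ℝ) / n) atTop
      (nhds (1 / 2)) := by
  have hn : Tendsto (fun n : ℕ => ((n : ℝ))⁻¹) atTop (nhds 0) :=
    tendsto_inv_atTop_zero.comp tendsto_natCast_atTop_atTop
  have hs : Tendsto (fun n : ℕ => (Real.sqrt n)⁻¹) atTop (nhds 0) :=
    tendsto_inv_atTop_zero.comp (Real.tendsto_sqrt_atTop.comp tendsto_natCast_atTop_atTop)
  have hlow : Tendsto (fun n : ℕ => 1 / 2 - 1 / 2 * (Real.sqrt n)⁻¹) atTop (nhds (1 / 2)) := by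
    simpa using (hs.const_mul (1 / 2 : ℝ)).const_sub (1 / 2 : ℝ)
  have hupp : Tendsto (fun n : ℕ => 1 / 2 + (n : ℝ)⁻¹) atTop (nhds (1 / 2)) := by
    simpa using hn.const_add (1 / 2 : ℝ)
  refine tendsto_of_tendsto_of_tendsto_of_le_of_le' hlow hupp ?_ ?_
  · filter_upwards [eventually_ge_atTop 2] with n h2
    obtain ⟨m, hm, hk⟩ := hu.exists_le_two_mul_nondetComplexity h2
    have hpos : (0 : ℝ) < n := by exact_mod_cast (by omega : 0 < n)
    have hm' : (m : ℝ) ≤ Real.sqrt n := Real.le_sqrt_of_sq_le (by rw [sq]; exact_mod_cast hm)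
    have hk' : (n : ℝ) + 1 ≤ 2 * nondetComplexity (wordPrefix u n) + m := by exact_mod_cast hk
    rw [le_div_iff₀ hpos, sub_mul, mul_assoc]
    have : (Real.sqrt n)⁻¹ * n = Real.sqrt n := by
      rw [inv_mul_eq_div, Real.div_sqrt]
    rw [this]
    linarith
  · filter_upwards [eventually_ge_atTop 2] with n h2
    have hk := nondetComplexity_le h2 (wordPrefix u n)
    have hpos : (0 : ℝ) < n := by exact_mod_cast (by omega : 0 < n)
    have hk' : 2 * (nondetComplexity (wordPrefix u n) : ℝ) ≤ n + 2 := by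
      exact_mod_cast (by omega : 2 * nondetComplexity (wordPrefix u n) ≤ n + 2)
    rw [div_le_iff₀ hpos, add_mul, inv_mul_cancel₀ hpos.ne']
    linarith

theorem OverlapFree.tendsto_ennreal_nondetComplexity_div {α : Type*} {u : ℕ → α}
    (hu : OverlapFree u) :
    Tendsto (fun n : ℕ => (nondetComplexity (wordPrefix u n) : ℝ≥0∞) / n) atTop
      (nhds (1 / 2)) := by
  have h := ENNReal.tendsto_ofReal hu.tendsto_nondetComplexity_div
  rw [ENNReal.ofReal_div_of_pos two_pos, ENNReal.ofReal_one, ENNReal.ofReal_ofNat] at h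
  refine h.congr' ?_
  filter_upwards [eventually_gt_atTop 0] with n hn
  rw [ENNReal.ofReal_div_of_pos (by exact_mod_cast hn), ENNReal.ofReal_natCast,
    ENNReal.ofReal_natCast]

theorem OverlapFree.tendsto_nondetComplexity_div_half {α : Type*} {u : ℕ → α}
    (hu : OverlapFree u) :
    Tendsto (fun n : ℕ => (nondetComplexity (wordPrefix u n) : ℝ≥0∞) / ((n : ℝ≥0∞) / 2)) atTop
      (nhds 1) := by
  have h := ENNReal.Tendsto.mul_const (b := 2) hu.tendsto_ennreal_nondetComplexity_div
    (Or.inr (by simp))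
  rw [ENNReal.div_mul_cancel two_ne_zero ENNReal.ofNat_ne_top] at h
  refine h.congr fun n => ?_
  rw [div_eq_mul_inv, div_eq_mul_inv, div_eq_mul_inv, ENNReal.mul_inv (by simp) (by simp), inv_inv,
    mul_assoc]

theorem mainTheorem2 :
    (1 / 2 : ℝ≥0∞) ≤ detHausdorffDim thueWord ∧
      nondetHausdorffDim thueWord = 1 ∧ nondetPackingDim thueWord = 1 := by
  refine ⟨?_, overlapFree_thueWord.tendsto_nondetComplexity_div_half.liminf_eq,
    overlapFree_thueWord.tendsto_nondetComplexity_div_half.limsup_eq⟩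
  rw [← overlapFree_thueWord.tendsto_ennreal_nondetComplexity_div.liminf_eq]
  refine liminf_le_liminf (Eventually.of_forall fun n => ?_)
  gcongr
  exact nondetComplexity_le_detComplexity _
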